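/- Let $\mathbb T=\mathbb R/2\pi\mathbb Z$, let $c\in\mathbb R\setminus\{0\}$, $T>2\pi/|c|$, let $q\in L^\infty(0,T;L^\infty(\mathbb T))$ be real-valued, and let $\omega\subset\mathbb T$ be a nonempty open set. Let $u\in L^2(0,T;H^2(\mathbb T))$ be real-valued and satisfy $$u_t-u_{txx}-c\,u_{xxx}+q\,u_x=0\qquad\text{in }\mathbb T\times(0,T)$$ in the sense of distributions, that is, $$\int_0^T\!\!\int_{\mathbb T}\Big[u\,\big(-\varphi_t+\varphi_{txx}+c\,\varphi_{xxx}\big)+q\,u_x\,\varphi\Big]\,dx\,dt=0\qquad\text{for all }\varphi\in C_c^\infty(\mathbb T\times(0,T)).$$ If $u(x,t)=0$ for almost every $(x,t)\in\omega\times(0,T)$, then $u=0$ almost everywhere in $\mathbb T\times(0,T)$. -/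

import Mathlib

open MeasureTheory Set
open scoped ContDiff

namespace KdVBBM

/-- The one-dimensional torus `ℝ / 2πℤ`. Its `volume` is Lebesgue measure, of total mass `2π`. -/
abbrev Torus : Type := AddCircle (2 * Real.pi)

instance factTwoPiPos : Fact (0 < 2 * Real.pi) := ⟨Real.two_pi_pos⟩

/-- The measure `dx dt` on the space-time cylinder `Torus × (0, T)`;
points of space-time are written `p = (x, t)`. -/
noncomputable def spaceTime (T : ℝ) : Measure (Torus × ℝ) :=
  (volume : Measure Torus).prod ((volume : Measure ℝ).restrict (Ioo 0 T))

/-- The derivative of a function on the torus. -/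
noncomputable def torusDeriv (f : Torus → ℝ) (x : Torus) : ℝ :=
  deriv (fun h : ℝ => f (x + (h : Torus))) 0

/-- Smoothness of a function on the torus: its periodic lift to `ℝ` is smooth. -/
def TorusSmooth (f : Torus → ℝ) : Prop :=
  ContDiff ℝ ∞ (fun x : ℝ => f (x : Torus))

/-- `g` is the weak (distributional) derivative of `f` on the torus, both being integrable. -/
def IsWeakDeriv (f g : Torus → ℝ) : Prop :=
  Integrable f ∧ Integrable g ∧
    ∀ χ : Torus → ℝ, TorusSmooth χ →
      ∫ x : Torus, f x * torusDeriv χ x = - ∫ x : Torus, g x * χ x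

/-- `v` is the weak derivative of `u` in the space variable, at almost every time in `(0, T)`. -/
def IsWeakSpaceDeriv (T : ℝ) (u v : Torus × ℝ → ℝ) : Prop :=
  ∀ᵐ t ∂((volume : Measure ℝ).restrict (Ioo 0 T)),
    IsWeakDeriv (fun x => u (x, t)) (fun x => v (x, t))

/-- `u ∈ L²(0, T; H²)` on the torus: `u` is measurable in `(x, t)`, for almost every `t` the
function `u(·, t)` has weak derivatives `u_x(·, t)` and `u_xx(·, t)`, and
`∫₀ᵀ (‖u(·, t)‖² + ‖u_x(·, t)‖² + ‖u_xx(·, t)‖²) dt < ∞` with the norms of `L²` of the torus,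
i.e. `u`, `u_x` and `u_xx` are square integrable on the cylinder. -/
def MemL2H2 (T : ℝ) (u : Torus × ℝ → ℝ) : Prop :=
  MemLp u 2 (spaceTime T) ∧
    ∃ ux uxx : Torus × ℝ → ℝ,
      MemLp ux 2 (spaceTime T) ∧ MemLp uxx 2 (spaceTime T) ∧
      IsWeakSpaceDeriv T u ux ∧ IsWeakSpaceDeriv T ux uxx

/-- The partial derivative in space of a function of `(x, t)`. -/
noncomputable def dx (φ : Torus × ℝ → ℝ) (p : Torus × ℝ) : ℝ :=
  torusDeriv (fun x => φ (x, p.2)) p.1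

/-- The partial derivative in time of a function of `(x, t)`. -/
noncomputable def dt (φ : Torus × ℝ → ℝ) (p : Torus × ℝ) : ℝ :=
  deriv (fun t : ℝ => φ (p.1, t)) p.2

/-- Test functions: smooth functions with compact support in `Torus × (0, T)`. -/
structure IsTestFunction (T : ℝ) (φ : Torus × ℝ → ℝ) : Prop where
  smooth : ContDiff ℝ ∞ (fun p : ℝ × ℝ => φ ((p.1 : Torus), p.2))
  hasCompactSupport : HasCompactSupport φ
  tsupport_subset : tsupport φ ⊆ univ ×ˢ Ioo 0 T

/-- `u` solves `u_t - u_txx - c u_xxx + q u_x = 0` on `Torus × (0, T)` in the sense of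
distributions: every derivative other than the one in the product `q u_x` is moved to the test
function, and `u_x` in that product is the square integrable weak derivative of `u`
(which is unique up to a null set). -/
def IsSolution (c T : ℝ) (q u : Torus × ℝ → ℝ) : Prop :=
  ∃ ux : Torus × ℝ → ℝ, MemLp ux 2 (spaceTime T) ∧ IsWeakSpaceDeriv T u ux ∧
    ∀ φ : Torus × ℝ → ℝ, IsTestFunction T φ →
      ∫ p, (u p * (- dt φ p + dt (dx (dx φ)) p + c * dx (dx (dx φ)) p)
        + q p * ux p * φ p) ∂(spaceTime T) = 0

end KdVBBM

/-! Set `w = u - u_xx` and `κ = 1 / c`. The equation becomes a first order transport equation, `(∂ₓ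
+ κ ∂ₜ) w = g` with `g = (1 - q / c) u_x`, so that `|g| ≤ C |u_x|` with `C = 1 + ‖q‖_∞ / |c|`. No
regularity of `q` beyond boundedness enters. Cut the torus at a point `a` of the open set. On the
rectangle `(a, a + 2π) × (0, T)` the function `u` vanishes near both lateral sides. A function that
vanishes near `x = a` is the integral of its weak derivative along any direction `v = (1, ·)`
(`IsWeakDirDeriv.ae_eq_rayPrimitive`). With the weight `exp (-l x)` this gives `‖f‖ ≤ (1 / l) ‖∂ᵥ
f‖` in weighted `L¹`, on any domain stable under moving back along `v` towards `x = a`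
(`IsWeakDirDeriv.lintegral_le`). The set of points whose backward characteristic reaches `x = a`
within `(0, T)` is stable both horizontally and along characteristics. There the estimates for `u`,
`u_x` and `w` combine to `‖u_x‖ ≤ (1 / l) ‖u_xx‖ ≤ (1 / l) (‖u‖ + ‖w‖) ≤ ((1 + C) / l²) ‖u_x‖`. For
large `l` this forces `u_x = 0`, hence `u = 0` (`ae_eq_zero_inflowDomain`). A point reflection of
the rectangle gives the same from the other side. A characteristic takes time `2π / |c| < T` to
cross the rectangle, so each one meets at least one lateral side, and the two domains cover
everything (`ae_eq_zero_of_vanish_sides`). -/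

namespace KdVBBM

/-! ### Weak directional derivatives in the plane -/

/-- Smooth functions with compact support in `R`. -/
structure IsPlaneTest (R : Set (ℝ × ℝ)) (φ : ℝ × ℝ → ℝ) : Prop where
  smooth : ContDiff ℝ ∞ φ
  hasCompactSupport : HasCompactSupport φ
  tsupport_subset : tsupport φ ⊆ R

/-- `g` is the weak derivative of `f` on `R` in the direction `v`, both being integrable. -/
structure IsWeakDirDeriv (R : Set (ℝ × ℝ)) (v : ℝ × ℝ) (f g : ℝ × ℝ → ℝ) : Prop where
  integrable : IntegrableOn f R
  integrable_deriv : IntegrableOn g R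
  integral_eq : ∀ φ, IsPlaneTest R φ →
    ∫ p in R, f p * fderiv ℝ φ p v = - ∫ p in R, g p * φ p

theorem IsPlaneTest.mono {R S : Set (ℝ × ℝ)} {φ : ℝ × ℝ → ℝ} (h : IsPlaneTest R φ)
    (hRS : R ⊆ S) : IsPlaneTest S φ :=
  ⟨h.1, h.2, h.3.trans hRS⟩

theorem IsPlaneTest.fderiv_apply {R : Set (ℝ × ℝ)} {φ : ℝ × ℝ → ℝ} (h : IsPlaneTest R φ)
    (v : ℝ × ℝ) : IsPlaneTest R (fun p => fderiv ℝ φ p v) where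
  smooth := (h.smooth.fderiv_right (m := ∞) (by simp)).clm_apply contDiff_const
  hasCompactSupport := h.hasCompactSupport.fderiv_apply (𝕜 := ℝ) v
  tsupport_subset := (tsupport_fderiv_apply_subset ℝ v).trans h.tsupport_subset

theorem IsPlaneTest.exists_bound {R : Set (ℝ × ℝ)} {φ : ℝ × ℝ → ℝ} (h : IsPlaneTest R φ) :
    ∃ C, ∀ p, ‖φ p‖ ≤ C :=
  h.hasCompactSupport.exists_bound_of_continuous h.smooth.continuous

/-- A weak derivative vanishes where the function does. -/
theorem IsWeakDirDeriv.ae_eq_zero {R V : Set (ℝ × ℝ)} {v : ℝ × ℝ} {f g : ℝ × ℝ → ℝ}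
    (h : IsWeakDirDeriv R v f g) (hV : IsOpen V) (hVR : V ⊆ R)
    (hf : ∀ᵐ p ∂(volume.restrict R), p ∈ V → f p = 0) :
    ∀ᵐ p ∂(volume.restrict R), p ∈ V → g p = 0 := by
  refine hV.ae_eq_zero_of_integral_contDiff_smul_eq_zero
    (h.integrable_deriv.locallyIntegrable.locallyIntegrableOn V) fun φ h1 h2 h3 => ?_
  have hφ : IsPlaneTest V φ := ⟨h1, h2, h3⟩
  have := h.integral_eq φ (hφ.mono hVR)
  rw [integral_eq_zero_of_ae] at this
  · simpa [mul_comm] using this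
  · filter_upwards [hf] with p hp
    by_cases hpV : p ∈ V
    · simp [hp hpV]
    · have : fderiv ℝ φ p v = 0 := by
        by_contra hne
        exact hpV (h3 (tsupport_fderiv_apply_subset ℝ v (subset_tsupport _ hne)))
      simp [this]

/-! ### Recovering a function from its derivative along a direction -/

/-- The integral of `χ` over the segment of length parameter `L` issued from `p` in the
direction `v`. -/
noncomputable def rayIntegral (L : ℝ) (v : ℝ × ℝ) (χ : ℝ × ℝ → ℝ) (p : ℝ × ℝ) : ℝ :=
  ∫ s in (0 : ℝ)..L, χ (p + s • v)

theorem contDiff_rayIntegral {L : ℝ} (hL : 0 ≤ L) {v : ℝ × ℝ} (hv : v.1 = 1) {χ : ℝ × ℝ → ℝ}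
    (hχ : ContDiff ℝ ∞ χ) (hc : HasCompactSupport χ) :
    ContDiff ℝ ∞ (rayIntegral L v χ) := by
  obtain ⟨B, hB⟩ := hc.isCompact.isBounded.exists_norm_le
  have hB' : ∀ p : ℝ × ℝ, B < |p.1| → χ p = 0 := fun p hp => by
    by_contra hne
    have := hB p (subset_tsupport _ hne)
    have h2 : ‖p.1‖ ≤ ‖p‖ := norm_fst_le p
    rw [Real.norm_eq_abs] at h2
    linarith
  rw [contDiff_iff_contDiffAt]
  intro p₀
  set r := |p₀.1| + 1
  have hs : IsOpen {p : ℝ × ℝ | |p.1| < r} := isOpen_lt (by fun_prop) continuous_const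
  have hf : LocallyIntegrable (indicator (Ioc 0 L) (fun _ => (1 : ℝ))) volume :=
    ((integrable_indicator_iff measurableSet_Ioc).2
      (integrableOn_const (by simp))).locallyIntegrable
  -- The ray integral is the convolution of the indicator of `(0, L]` with `y ↦ χ (p - y • v)`,
  -- evaluated at `0`, with `p` as a parameter. Since `v.1 = 1`, for `|p.1| < r` these functions of
  -- `y` are supported in one compact interval.
  have key := contDiffOn_convolution_right_with_param (n := ⊤)
    (g := fun (p : ℝ × ℝ) (y : ℝ) => χ (p - y • v)) (ContinuousLinearMap.mul ℝ ℝ) (μ := volume) hs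
    (isCompact_Icc (a := -(B + r)) (b := B + r)) (fun p y hp hy => by
      apply hB'
      simp only [mem_Icc, mem_ofPred_eq, ← abs_le, not_le] at hp hy
      have : |y| ≤ |p.1 - y| + |p.1| := by
        have := abs_sub_abs_le_abs_sub y p.1
        rw [abs_sub_comm] at this
        linarith
      simp only [Prod.fst_sub, Prod.smul_fst, hv, smul_eq_mul, mul_one]
      linarith) hf (by
        apply ContDiff.contDiffOn
        exact hχ.comp (contDiff_fst.sub (contDiff_snd.smul contDiff_const)))
  have key2 : ContDiffAt ℝ ∞ (fun p : ℝ × ℝ => (p, (0 : ℝ))) p₀ := by fun_prop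
  have := (key.contDiffAt (x := (p₀, 0)) ((hs.prod isOpen_univ).mem_nhds
    ⟨by simp [r], mem_univ _⟩)).comp p₀ key2
  convert this using 1
  ext p
  simp only [rayIntegral, Function.comp, convolution, ContinuousLinearMap.mul_apply']
  rw [intervalIntegral.integral_of_le hL, ← integral_indicator measurableSet_Ioc]
  congr 1
  ext t
  by_cases ht : t ∈ Ioc 0 L <;> simp [ht]

/-- Moving `p` along `v` only slides the window of integration, so the fundamental theorem of
calculus leaves the two endpoint values. -/
theorem fderiv_rayIntegral {L : ℝ} (hL : 0 ≤ L) {v : ℝ × ℝ} (hv : v.1 = 1) {χ : ℝ × ℝ → ℝ}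
    (hχ : ContDiff ℝ ∞ χ) (hc : HasCompactSupport χ) (p : ℝ × ℝ) :
    fderiv ℝ (rayIntegral L v χ) p v = χ (p + L • v) - χ p := by
  have hcont : Continuous fun s : ℝ => χ (p + s • v) := by
    have := hχ.continuous; fun_prop
  have h1 : HasDerivAt (fun r : ℝ => rayIntegral L v χ (p + r • v))
      (χ (p + L • v) - χ p) 0 := by
    have h2 : (fun r : ℝ => rayIntegral L v χ (p + r • v)) =
        fun r : ℝ => (∫ s in (0 : ℝ)..(r + L), χ (p + s • v)) - ∫ s in (0 : ℝ)..r, χ (p + s • v) := by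
      ext r
      rw [intervalIntegral.integral_interval_sub_left (hcont.intervalIntegrable _ _)
        (hcont.intervalIntegrable _ _)]
      have := intervalIntegral.integral_comp_add_left (a := 0) (b := L)
        (fun s => χ (p + s • v)) r
      rw [add_zero] at this
      rw [← this]
      simp only [rayIntegral, add_smul, add_assoc]
    rw [h2]
    have h3 : HasDerivAt (fun r : ℝ => ∫ s in (0 : ℝ)..(r + L), χ (p + s • v))
        (χ (p + (0 + L) • v)) 0 :=
      HasDerivAt.comp_add_const (x := 0) (a := L) <|
        intervalIntegral.integral_hasDerivAt_right (hcont.intervalIntegrable _ _)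
        (hcont.stronglyMeasurableAtFilter _ _) hcont.continuousAt
    have h4 : HasDerivAt (fun r : ℝ => ∫ s in (0 : ℝ)..r, χ (p + s • v))
        (χ (p + (0 : ℝ) • v)) 0 :=
      intervalIntegral.integral_hasDerivAt_right (hcont.intervalIntegrable _ _)
        (hcont.stronglyMeasurableAtFilter _ _) hcont.continuousAt
    simpa using h3.fun_sub h4
  have hd : HasFDerivAt (rayIntegral L v χ) (fderiv ℝ (rayIntegral L v χ) p) (p + (0 : ℝ) • v) := by
    simpa using ((contDiff_rayIntegral hL hv hχ hc).differentiable (by simp) p).hasFDerivAt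
  have h5 : HasDerivAt (fun r : ℝ => p + r • v) v 0 := by
    simpa using ((hasDerivAt_id (0 : ℝ)).smul_const v).const_add p
  have h6 := hd.comp_hasDerivAt (0 : ℝ) h5
  exact HasDerivAt.unique h6 h1

/-- Testing a weak directional derivative against the ray integral of `χ`, when both functions
vanish near the inflow boundary `x = a`. -/
theorem IsWeakDirDeriv.integral_mul_eq {R D : Set (ℝ × ℝ)} {v : ℝ × ℝ} {f g : ℝ × ℝ → ℝ}
    {a b η : ℝ} (h : IsWeakDirDeriv R v f g) (hv : v.1 = 1) (hab : a < b) (hη : 0 < η)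
    (hR : ∀ p ∈ R, a < p.1 ∧ p.1 < b) (hDR : D ⊆ R)
    (hD : ∀ p ∈ D, ∀ s : ℝ, 0 ≤ s → a < p.1 - s → p - s • v ∈ D)
    (hf : ∀ᵐ p ∂(volume.restrict R), p.1 < a + η → f p = 0)
    (hg : ∀ᵐ p ∂(volume.restrict R), p.1 < a + η → g p = 0)
    (χ : ℝ × ℝ → ℝ) (hχ : IsPlaneTest D χ) :
    ∫ p in R, f p * χ p = ∫ p in R, g p * rayIntegral (b - a) v χ p := by
  set L := b - a with hLdef
  have hL : 0 ≤ L := by linarith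
  set Φ := rayIntegral L v χ with hΦ
  have hΦs : ContDiff ℝ ∞ Φ := contDiff_rayIntegral hL hv hχ.smooth hχ.hasCompactSupport
  -- A cutoff near the inflow side: `0` up to `a + η / 3`, `1` from `a + 2η / 3` on. It makes the
  -- test function compactly supported in `R`, and the integrals do not see it, because `f` and `g`
  -- vanish for `x < a + η`.
  set θ : ℝ → ℝ := fun x => Real.smoothTransition ((x - a - η / 3) / (η / 3)) with hθ
  have hθs : ContDiff ℝ ∞ θ := by
    apply Real.smoothTransition.contDiff.comp
    fun_prop
  have hθ0 : ∀ x, x ≤ a + η / 3 → θ x = 0 := fun x hx =>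
    Real.smoothTransition.zero_of_nonpos (div_nonpos_of_nonpos_of_nonneg (by linarith) (by linarith))
  have hθ1 : ∀ x, a + 2 * η / 3 ≤ x → θ x = 1 := fun x hx =>
    Real.smoothTransition.one_of_one_le ((one_le_div (by linarith)).2 (by linarith))
  set φ : ℝ × ℝ → ℝ := fun p => θ p.1 * Φ p with hφ
  have hφs : ContDiff ℝ ∞ φ := (hθs.comp contDiff_fst).mul hΦs
  set K : Set (ℝ × ℝ) := ((fun z : (ℝ × ℝ) × ℝ => z.1 - z.2 • v) '' (tsupport χ ×ˢ Icc 0 L)) ∩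
    {p | a + η / 3 ≤ p.1} with hK
  have hKc : IsCompact K := by
    refine IsCompact.inter_right ?_ (isClosed_le continuous_const continuous_fst)
    exact (hχ.hasCompactSupport.isCompact.prod isCompact_Icc).image (by fun_prop)
  have hKD : K ⊆ D := by
    rintro _ ⟨⟨⟨q, s⟩, ⟨hq, hs⟩, rfl⟩, hx⟩
    refine hD q (hχ.tsupport_subset hq) s hs.1 ?_
    simp only [mem_ofPred_eq, Prod.fst_sub, Prod.smul_fst, hv, smul_eq_mul, mul_one] at hx
    linarith
  have hφK : Function.support φ ⊆ K := by
    intro p hp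
    have hp1 : a + η / 3 < p.1 := by
      by_contra hle
      exact hp (by simp [hφ, hθ0 p.1 (not_lt.1 hle)])
    have hp2 : Φ p ≠ 0 := fun h0 => hp (by simp [hφ, h0])
    obtain ⟨s, hs, hsχ⟩ : ∃ s ∈ Icc 0 L, χ (p + s • v) ≠ 0 := by
      by_contra! hcon
      apply hp2
      rw [hΦ, rayIntegral, intervalIntegral.integral_congr (g := fun _ => (0 : ℝ))]
      · simp
      · intro s hs
        rw [uIcc_of_le hL] at hs
        exact hcon s hs
    exact ⟨⟨(p + s • v, s), ⟨subset_tsupport _ hsχ, hs⟩, by simp⟩, hp1.le⟩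
  have hφt : IsPlaneTest R φ := by
    have : tsupport φ ⊆ K := closure_minimal hφK hKc.isClosed
    exact ⟨hφs, hKc.of_isClosed_subset (isClosed_tsupport _) this, (this.trans hKD).trans hDR⟩
  have key := h.integral_eq φ hφt
  have h1 : ∫ p in R, f p * fderiv ℝ φ p v = ∫ p in R, -(f p * χ p) := by
    apply integral_congr_ae
    have hRm : ∀ᵐ p ∂(volume.restrict R), a < p.1 := by
      have : ∀ᵐ p ∂(volume.restrict {p : ℝ × ℝ | a < p.1}), a < p.1 :=
        ae_restrict_mem (measurableSet_lt measurable_const measurable_fst)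
      exact ae_mono (Measure.restrict_mono (fun p hp => (hR p hp).1) le_rfl) this
    filter_upwards [hf, hRm] with p hp hpa
    by_cases hpx : p.1 < a + η
    · simp [hp hpx]
    · have he : φ =ᶠ[nhds p] Φ := by
        have : {q : ℝ × ℝ | a + 2 * η / 3 < q.1} ∈ nhds p :=
          (isOpen_lt continuous_const continuous_fst).mem_nhds (by
            simp only [mem_ofPred_eq]; linarith)
        filter_upwards [this] with q hq
        simp [hφ, hθ1 q.1 (show a + 2 * η / 3 < q.1 from hq).le]
      rw [he.fderiv_eq, hΦ, fderiv_rayIntegral hL hv hχ.smooth hχ.hasCompactSupport]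
      -- A displacement of `L = b - a` from a point with `x > a` ends beyond `x = b`, outside the
      -- support of `χ`.
      have : χ (p + L • v) = 0 := by
        by_contra hne
        have := (hR _ (hDR (hχ.tsupport_subset (subset_tsupport _ hne)))).2
        simp only [Prod.fst_add, Prod.smul_fst, hv, smul_eq_mul, mul_one] at this
        linarith
      rw [this]; ring
  have h2 : ∫ p in R, g p * φ p = ∫ p in R, g p * Φ p := by
    apply integral_congr_ae
    filter_upwards [hg] with p hp
    by_cases hpx : p.1 < a + η
    · simp [hp hpx]
    · simp [hφ, hθ1 p.1 (by linarith)]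
  rw [h1, h2, integral_neg, neg_inj] at key
  exact key

/-- Each slice is a translation. This supplies the joint integrability of `(s, p) ↦ G (p - s • v)`
that Fubini needs. -/
theorem measurePreserving_shear (L : ℝ) (v : ℝ × ℝ) :
    MeasurePreserving (fun z : ℝ × (ℝ × ℝ) => (z.1, z.2 - z.1 • v))
      ((volume.restrict (Ioc 0 L)).prod volume) ((volume.restrict (Ioc 0 L)).prod volume) := by
  refine (MeasurePreserving.id _).skew_product (g := fun s p => p - s • v) (by fun_prop) ?_
  filter_upwards with s
  exact (measurePreserving_sub_right volume (s • v)).map_eq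

theorem integrable_comp_shear {L : ℝ} (v : ℝ × ℝ) {G : ℝ × ℝ → ℝ} (hG : Integrable G) :
    Integrable (fun z : ℝ × (ℝ × ℝ) => G (z.2 - z.1 • v))
      ((volume.restrict (Ioc 0 L)).prod volume) := by
  have : Integrable (fun z : ℝ × (ℝ × ℝ) => G z.2) ((volume.restrict (Ioc 0 L)).prod volume) :=
    hG.comp_snd _
  exact (measurePreserving_shear L v).integrable_comp_of_integrable this

/-- The primitive of `G` along the direction `v`. -/
noncomputable def rayPrimitive (L : ℝ) (v : ℝ × ℝ) (G : ℝ × ℝ → ℝ) (p : ℝ × ℝ) : ℝ :=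
  ∫ s in Ioc 0 L, G (p - s • v)

theorem integrable_rayPrimitive {L : ℝ} (v : ℝ × ℝ) {G : ℝ × ℝ → ℝ} (hG : Integrable G) :
    Integrable (rayPrimitive L v G) :=
  (integrable_comp_shear (L := L) v hG).integral_prod_right

/-- Forward and backward integration along `v` are adjoint, by Fubini and translation invariance. -/
theorem integral_mul_rayIntegral {L : ℝ} (hL : 0 ≤ L) (v : ℝ × ℝ) {G χ : ℝ × ℝ → ℝ}
    (hG : Integrable G) (hχ : Continuous χ) (hχb : ∃ C, ∀ p, ‖χ p‖ ≤ C) :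
    ∫ p, G p * rayIntegral L v χ p = ∫ p, rayPrimitive L v G p * χ p := by
  obtain ⟨C, hC⟩ := hχb
  have i1 : Integrable (fun z : ℝ × (ℝ × ℝ) => G z.2 * χ (z.2 + z.1 • v))
      ((volume.restrict (Ioc 0 L)).prod volume) := by
    refine (hG.comp_snd _).mul_bdd (c := C) ?_ (Filter.Eventually.of_forall fun z => hC _)
    exact (by fun_prop : Continuous fun z : ℝ × (ℝ × ℝ) => χ (z.2 + z.1 • v)).aestronglyMeasurable
  have i2 : Integrable (fun z : ℝ × (ℝ × ℝ) => G (z.2 - z.1 • v) * χ z.2)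
      ((volume.restrict (Ioc 0 L)).prod volume) := by
    refine (integrable_comp_shear v hG).mul_bdd (c := C) ?_ (Filter.Eventually.of_forall fun z => hC _)
    exact (by fun_prop : Continuous fun z : ℝ × (ℝ × ℝ) => χ z.2).aestronglyMeasurable
  have e1 : ∫ p, G p * rayIntegral L v χ p =
      ∫ s in Ioc 0 L, ∫ p, G p * χ (p + s • v) := by
    rw [integral_integral_swap (f := fun s p => G p * χ (p + s • v)) i1]
    refine integral_congr_ae (Filter.Eventually.of_forall fun p => ?_)
    simp only [rayIntegral, intervalIntegral.integral_of_le hL, integral_const_mul]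
  have e2 : ∫ p, rayPrimitive L v G p * χ p =
      ∫ s in Ioc 0 L, ∫ p, G (p - s • v) * χ p := by
    rw [integral_integral_swap (f := fun s p => G (p - s • v) * χ p) i2]
    refine integral_congr_ae (Filter.Eventually.of_forall fun p => ?_)
    simp only [rayPrimitive, integral_mul_const]
  rw [e1, e2]
  refine integral_congr_ae (Filter.Eventually.of_forall fun s => ?_)
  have := integral_sub_right_eq_self (μ := (volume : Measure (ℝ × ℝ)))
    (fun p => G p * χ (p + s • v)) (s • v)
  simp only [sub_add_cancel] at this
  exact this.symm

/-- A function vanishing near the inflow boundary is the primitive of its weak derivative. -/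
theorem IsWeakDirDeriv.ae_eq_rayPrimitive {R D : Set (ℝ × ℝ)} {v : ℝ × ℝ} {f g : ℝ × ℝ → ℝ}
    {a b η : ℝ} (h : IsWeakDirDeriv R v f g) (hv : v.1 = 1) (hab : a < b) (hη : 0 < η)
    (hR : ∀ p ∈ R, a < p.1 ∧ p.1 < b) (hRm : MeasurableSet R) (hDo : IsOpen D) (hDR : D ⊆ R)
    (hD : ∀ p ∈ D, ∀ s : ℝ, 0 ≤ s → a < p.1 - s → p - s • v ∈ D)
    (hf : ∀ᵐ p ∂(volume.restrict R), p.1 < a + η → f p = 0)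
    (hg : ∀ᵐ p ∂(volume.restrict R), p.1 < a + η → g p = 0) :
    ∀ᵐ p ∂volume, p ∈ D → f p = rayPrimitive (b - a) v (R.indicator g) p := by
  have hF : Integrable (R.indicator f) := (integrable_indicator_iff hRm).2 h.integrable
  have hG : Integrable (R.indicator g) := (integrable_indicator_iff hRm).2 h.integrable_deriv
  have hP := integrable_rayPrimitive (L := b - a) v hG
  have := hDo.ae_eq_zero_of_integral_contDiff_smul_eq_zero
    ((hF.sub hP).locallyIntegrable.locallyIntegrableOn D) fun χ h1 h2 h3 => by
      have hχ : IsPlaneTest D χ := ⟨h1, h2, h3⟩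
      obtain ⟨C, hC⟩ := hχ.exists_bound
      have key := h.integral_mul_eq hv hab hη hR hDR hD hf hg χ hχ
      rw [← integral_indicator hRm, ← integral_indicator hRm] at key
      simp only [indicator_mul_left] at key
      rw [integral_mul_rayIntegral (by linarith) v hG h1.continuous ⟨C, hC⟩] at key
      have hm := h1.continuous.aestronglyMeasurable (μ := (volume : Measure (ℝ × ℝ)))
      have e : ∀ p, χ p • (R.indicator f - rayPrimitive (b - a) v (R.indicator g)) p =
          R.indicator f p * χ p - rayPrimitive (b - a) v (R.indicator g) p * χ p := fun p => by
        simp only [Pi.sub_apply, smul_eq_mul]; ring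
      simp only [e]
      rw [integral_sub (hF.mul_bdd hm (Filter.Eventually.of_forall hC))
        (hP.mul_bdd hm (Filter.Eventually.of_forall hC)), key, sub_self]
  filter_upwards [this] with p hp hpD
  have := hp hpD
  rw [Pi.sub_apply, indicator_of_mem (hDR hpD), sub_eq_zero] at this
  exact this

/-! ### Weighted `L¹` estimates -/

theorem lintegral_exp_le {l L : ℝ} (hl : 0 < l) (hL : 0 ≤ L) :
    ∫⁻ s in Ioc 0 L, ENNReal.ofReal (Real.exp (-l * s)) ≤ ENNReal.ofReal (1 / l) := by
  rw [← ofReal_integral_eq_lintegral_ofReal]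
  · apply ENNReal.ofReal_le_ofReal
    rw [← intervalIntegral.integral_of_le hL]
    have : ∫ s in (0 : ℝ)..L, Real.exp (-l * s) = (1 - Real.exp (-l * L)) / l := by
      rw [intervalIntegral.integral_comp_mul_left _ (by linarith : -l ≠ 0)]
      simp
      field_simp
      ring
    rw [this]
    gcongr
    linarith [Real.exp_pos (-l * L)]
  · exact (by fun_prop : Continuous fun s : ℝ => Real.exp (-l * s)).integrableOn_Ioc
  · exact Filter.Eventually.of_forall fun s => (Real.exp_pos _).le

/-- Weighted estimate for the primitive along `v`. -/
theorem lintegral_rayPrimitive_le {D : Set (ℝ × ℝ)} {v : ℝ × ℝ} {G : ℝ × ℝ → ℝ} {a L l : ℝ}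
    (hv : v.1 = 1) (hl : 0 < l) (hL : 0 ≤ L) (hG : Integrable G)
    (hGR : ∀ p, G p ≠ 0 → a < p.1) (hDm : MeasurableSet D)
    (hD : ∀ p ∈ D, ∀ s : ℝ, 0 ≤ s → a < p.1 - s → p - s • v ∈ D) :
    ∫⁻ p in D, ENNReal.ofReal (Real.exp (-l * p.1)) * ‖rayPrimitive L v G p‖ₑ ≤
      ENNReal.ofReal (1 / l) * ∫⁻ p in D, ENNReal.ofReal (Real.exp (-l * p.1)) * ‖G p‖ₑ := by
  set E : ℝ → ENNReal := fun x => ENNReal.ofReal (Real.exp (-l * x)) with hE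
  have hEm : Measurable E := by fun_prop
  have hEadd : ∀ x s, E (x + s) = E s * E x := fun x s => by
    simp only [hE]
    rw [← ENNReal.ofReal_mul (Real.exp_pos _).le, ← Real.exp_add]
    congr 2; ring
  have hm : AEMeasurable (fun z : ℝ × (ℝ × ℝ) => D.indicator (fun _ => 1) z.2 *
      (E z.2.1 * ‖G (z.2 - z.1 • v)‖ₑ)) ((volume.restrict (Ioc 0 L)).prod volume) := by
    have h1 := (integrable_comp_shear (L := L) v hG).aestronglyMeasurable.enorm
    have h2 : Measurable (D.indicator (fun _ => (1 : ENNReal))) := measurable_const.indicator hDm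
    exact (h2.comp measurable_snd).aemeasurable.mul
      ((hEm.comp (measurable_fst.comp measurable_snd)).aemeasurable.mul h1)
  calc ∫⁻ p in D, E p.1 * ‖rayPrimitive L v G p‖ₑ
      ≤ ∫⁻ p in D, E p.1 * ∫⁻ s in Ioc 0 L, ‖G (p - s • v)‖ₑ := by
        gcongr with p
        exact enorm_integral_le_lintegral_enorm _
    _ = ∫⁻ p, ∫⁻ s in Ioc 0 L, D.indicator (fun _ => 1) p * (E p.1 * ‖G (p - s • v)‖ₑ) := by
        rw [← lintegral_indicator hDm]
        congr 1
        ext p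
        by_cases hp : p ∈ D
        · simp [hp, lintegral_const_mul' _ _ (show E p.1 ≠ ⊤ from ENNReal.ofReal_ne_top)]
        · simp [hp]
    _ = ∫⁻ s in Ioc 0 L, ∫⁻ p, D.indicator (fun _ => 1) p * (E p.1 * ‖G (p - s • v)‖ₑ) :=
        (lintegral_lintegral_swap hm).symm
    _ ≤ ∫⁻ s in Ioc 0 L, E s * ∫⁻ p in D, E p.1 * ‖G p‖ₑ := by
        refine setLIntegral_mono' measurableSet_Ioc fun s hs => ?_
        -- After the change of variables `p ↦ p + s • v` the weight gains the factor `exp (-l s)`.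
        -- Where `G p ≠ 0` one has `a < p.1`, so backward stability of `D` brings `p + s • v ∈ D`
        -- back to `p ∈ D`.
        rw [← lintegral_add_right_eq_self _ (s • v), ← lintegral_indicator hDm,
          ← lintegral_const_mul' _ _ (show E s ≠ ⊤ from ENNReal.ofReal_ne_top)]
        refine lintegral_mono fun p => ?_
        simp only [add_sub_cancel_right, Prod.fst_add, Prod.smul_fst, hv, smul_eq_mul, mul_one]
        by_cases hp : p + s • v ∈ D
        · by_cases hGp : G p = 0
          · simp [hGp]
          · have hpD : p ∈ D := by
              have := hD _ hp s hs.1.le (by simpa [hv] using hGR p hGp)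
              simpa using this
            simp [hp, hpD, hEadd, mul_assoc]
        · simp [hp]
    _ = (∫⁻ s in Ioc 0 L, E s) * ∫⁻ p in D, E p.1 * ‖G p‖ₑ := lintegral_mul_const _ hEm
    _ ≤ _ := by
        gcongr
        exact lintegral_exp_le hl hL

/-- The basic Carleman type estimate along the direction `v`. -/
theorem IsWeakDirDeriv.lintegral_le {R D : Set (ℝ × ℝ)} {v : ℝ × ℝ} {f g : ℝ × ℝ → ℝ}
    {a b η l : ℝ} (h : IsWeakDirDeriv R v f g) (hl : 0 < l) (hv : v.1 = 1) (hab : a < b)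
    (hη : 0 < η) (hR : ∀ p ∈ R, a < p.1 ∧ p.1 < b) (hRm : MeasurableSet R) (hDo : IsOpen D)
    (hDR : D ⊆ R) (hD : ∀ p ∈ D, ∀ s : ℝ, 0 ≤ s → a < p.1 - s → p - s • v ∈ D)
    (hf : ∀ᵐ p ∂(volume.restrict R), p.1 < a + η → f p = 0)
    (hg : ∀ᵐ p ∂(volume.restrict R), p.1 < a + η → g p = 0) :
    ∫⁻ p in D, ENNReal.ofReal (Real.exp (-l * p.1)) * ‖f p‖ₑ ≤
      ENNReal.ofReal (1 / l) * ∫⁻ p in D, ENNReal.ofReal (Real.exp (-l * p.1)) * ‖g p‖ₑ := by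
  have hG : Integrable (R.indicator g) := (integrable_indicator_iff hRm).2 h.integrable_deriv
  have key := lintegral_rayPrimitive_le (a := a) hv hl (sub_nonneg.2 hab.le) hG
    (fun p hp => (hR p (mem_of_indicator_ne_zero hp)).1) hDo.measurableSet hD
  have e1 : ∫⁻ p in D, ENNReal.ofReal (Real.exp (-l * p.1)) * ‖f p‖ₑ =
      ∫⁻ p in D, ENNReal.ofReal (Real.exp (-l * p.1)) *
        ‖rayPrimitive (b - a) v (R.indicator g) p‖ₑ := by
    apply lintegral_congr_ae
    rw [Filter.EventuallyEq, ae_restrict_iff' hDo.measurableSet]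
    filter_upwards [h.ae_eq_rayPrimitive hv hab hη hR hRm hDo hDR hD hf hg] with p hp hpD
    rw [hp hpD]
  have e2 : ∫⁻ p in D, ENNReal.ofReal (Real.exp (-l * p.1)) * ‖R.indicator g p‖ₑ =
      ∫⁻ p in D, ENNReal.ofReal (Real.exp (-l * p.1)) * ‖g p‖ₑ :=
    setLIntegral_congr_fun hDo.measurableSet fun p hp => by
      simp only [indicator_of_mem (hDR hp)]
  rw [e1, ← e2]
  exact key

/-! ### Point reflections -/

theorem ae_comp_const_sub {R : Set (ℝ × ℝ)} {z : ℝ × ℝ} (hz : ∀ p, z - p ∈ R ↔ p ∈ R)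
    {P : ℝ × ℝ → Prop} (h : ∀ᵐ p ∂(volume.restrict R), P p) :
    ∀ᵐ p ∂(volume.restrict R), P (z - p) := by
  have := ((Measure.measurePreserving_sub_left volume z).restrict_preimage_emb
    (Homeomorph.subLeft z).measurableEmbedding R).quasiMeasurePreserving.ae h
  rwa [show (fun p => z - p) ⁻¹' R = R from Set.ext hz] at this

theorem setIntegral_comp_const_sub {R : Set (ℝ × ℝ)} {z : ℝ × ℝ} (hz : ∀ p, z - p ∈ R ↔ p ∈ R)
    (F : ℝ × ℝ → ℝ) : ∫ p in R, F (z - p) = ∫ p in R, F p := by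
  have := (Measure.measurePreserving_sub_left volume z).setIntegral_preimage_emb
    (Homeomorph.subLeft z).measurableEmbedding F R
  rwa [show (fun p => z - p) ⁻¹' R = R from Set.ext hz] at this

theorem integrableOn_comp_const_sub {R : Set (ℝ × ℝ)} {z : ℝ × ℝ} (hz : ∀ p, z - p ∈ R ↔ p ∈ R)
    {F : ℝ × ℝ → ℝ} (hF : IntegrableOn F R) : IntegrableOn (fun p => F (z - p)) R := by
  have := ((Measure.measurePreserving_sub_left volume z).integrableOn_comp_preimage
    (Homeomorph.subLeft z).measurableEmbedding (f := F) (s := R)).2 hF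
  rwa [show (fun p => z - p) ⁻¹' R = R from Set.ext hz] at this

theorem IsPlaneTest.comp_const_sub {R : Set (ℝ × ℝ)} {z : ℝ × ℝ} (hz : ∀ p, z - p ∈ R ↔ p ∈ R)
    {φ : ℝ × ℝ → ℝ} (h : IsPlaneTest R φ) : IsPlaneTest R (fun p => φ (z - p)) where
  smooth := h.smooth.comp (contDiff_const.sub contDiff_id)
  hasCompactSupport := h.hasCompactSupport.comp_homeomorph (Homeomorph.subLeft z)
  tsupport_subset := by
    have : tsupport (fun p => φ (z - p)) = Homeomorph.subLeft z ⁻¹' tsupport φ :=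
      tsupport_comp_eq_preimage φ (Homeomorph.subLeft z)
    rw [this]
    exact fun p hp => (hz p).1 (h.tsupport_subset hp)

/-- Point reflections change the sign of weak directional derivatives. -/
theorem IsWeakDirDeriv.comp_const_sub {R : Set (ℝ × ℝ)} {v z : ℝ × ℝ} {f g : ℝ × ℝ → ℝ}
    (h : IsWeakDirDeriv R v f g) (hz : ∀ p, z - p ∈ R ↔ p ∈ R) :
    IsWeakDirDeriv R v (fun p => f (z - p)) (fun p => -g (z - p)) where
  integrable := integrableOn_comp_const_sub hz h.integrable
  integrable_deriv := (integrableOn_comp_const_sub hz h.integrable_deriv).neg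
  integral_eq φ hφ := by
    have key := h.integral_eq _ (hφ.comp_const_sub hz)
    rw [← setIntegral_comp_const_sub hz, ← setIntegral_comp_const_sub hz (fun p => g p * _)] at key
    have hd : ∀ p, fderiv ℝ (fun q => φ (z - q)) (z - p) v = - fderiv ℝ φ p v := fun p => by
      have h1 : HasFDerivAt φ (fderiv ℝ φ p) (z - (z - p)) := by
        simpa using (hφ.smooth.differentiable (by simp) p).hasFDerivAt
      have h2 := h1.comp (z - p) ((hasFDerivAt_id (z - p)).const_sub z)
      have h3 : HasFDerivAt (fun q => φ (z - q)) _ (z - p) := h2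
      rw [h3.fderiv]; simp
    simp only [hd, sub_sub_cancel, mul_neg, integral_neg] at key
    simp only [neg_mul, integral_neg]
    linarith

theorem IsWeakDirDeriv.neg {R : Set (ℝ × ℝ)} {v : ℝ × ℝ} {f g : ℝ × ℝ → ℝ}
    (h : IsWeakDirDeriv R v f g) : IsWeakDirDeriv R v (fun p => -f p) (fun p => -g p) where
  integrable := h.integrable.neg
  integrable_deriv := h.integrable_deriv.neg
  integral_eq φ hφ := by simp only [neg_mul, integral_neg, h.integral_eq φ hφ]

/-! ### Unique continuation from the lateral sides -/

/-- The points of the rectangle `(a, b) × (0, T)` whose characteristic of slope `κ` meets the side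
`x = a` at a time of `(0, T)`. -/
def inflowDomain (a b T κ : ℝ) : Set (ℝ × ℝ) :=
  {p | p ∈ Ioo a b ×ˢ Ioo 0 T ∧ p.2 - κ * (p.1 - a) ∈ Ioo 0 T}

theorem isOpen_inflowDomain (a b T κ : ℝ) : IsOpen (inflowDomain a b T κ) :=
  (isOpen_Ioo.prod isOpen_Ioo).inter (isOpen_Ioo.preimage (by fun_prop :
    Continuous fun p : ℝ × ℝ => p.2 - κ * (p.1 - a)))

/-- The foot of the characteristic on `x = a` does not change, and the new time lies between the old
time and the time of the foot. -/
theorem sub_smul_mem_inflowDomain {a b T κ : ℝ} {p : ℝ × ℝ} (hp : p ∈ inflowDomain a b T κ)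
    {s : ℝ} (hs : 0 ≤ s) (hps : a < p.1 - s) : p - s • ((1 : ℝ), κ) ∈ inflowDomain a b T κ := by
  obtain ⟨⟨⟨h1, h2⟩, h3, h4⟩, h5, h6⟩ := hp
  refine ⟨⟨⟨?_, ?_⟩, ?_, ?_⟩, ?_, ?_⟩ <;>
    simp only [Prod.fst_sub, Prod.snd_sub, Prod.smul_fst, Prod.smul_snd, smul_eq_mul, mul_one]
  · exact hps
  · linarith
  · rcases le_total 0 κ with hκ | hκ <;> nlinarith
  · rcases le_total 0 κ with hκ | hκ <;> nlinarith
  · linarith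
  · linarith

/-- The time of the foot moves towards `p.2`, hence stays in `(0, T)`. Thus one domain serves both
directions of differentiation. -/
theorem sub_smul_mem_inflowDomain_horizontal {a b T κ : ℝ} {p : ℝ × ℝ}
    (hp : p ∈ inflowDomain a b T κ) {s : ℝ} (hs : 0 ≤ s) (hps : a < p.1 - s) :
    p - s • ((1 : ℝ), (0 : ℝ)) ∈ inflowDomain a b T κ := by
  obtain ⟨⟨⟨h1, h2⟩, h3, h4⟩, h5, h6⟩ := hp
  refine ⟨⟨⟨?_, ?_⟩, ?_, ?_⟩, ?_, ?_⟩ <;>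
    simp only [Prod.fst_sub, Prod.snd_sub, Prod.smul_fst, Prod.smul_snd, smul_eq_mul, mul_one,
      mul_zero, sub_zero]
  · exact hps
  · linarith
  · exact h3
  · exact h4
  · rcases le_total 0 κ with hκ | hκ <;> nlinarith
  · rcases le_total 0 κ with hκ | hκ <;> nlinarith

/-- Unique continuation from the side `x = a` for the coupled system
`∂ₓ f₀ = f₁`, `∂ₓ f₁ = f₂`, `(∂ₓ + κ ∂ₜ) (f₀ - f₂) = g` with `|g| ≤ C |f₁|`. -/
theorem ae_eq_zero_inflowDomain {a b T κ η C : ℝ} (hab : a < b) (hη : 0 < η) (hC : 0 ≤ C)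
    {f₀ f₁ f₂ g : ℝ × ℝ → ℝ}
    (h₀ : IsWeakDirDeriv (Ioo a b ×ˢ Ioo 0 T) (1, 0) f₀ f₁)
    (h₁ : IsWeakDirDeriv (Ioo a b ×ˢ Ioo 0 T) (1, 0) f₁ f₂)
    (hw : IsWeakDirDeriv (Ioo a b ×ˢ Ioo 0 T) (1, κ) (fun p => f₀ p - f₂ p) g)
    (hg : ∀ᵐ p ∂(volume.restrict (Ioo a b ×ˢ Ioo 0 T)), |g p| ≤ C * |f₁ p|)
    (hf : ∀ᵐ p ∂(volume.restrict (Ioo a b ×ˢ Ioo 0 T)), p.1 < a + η → f₀ p = 0) :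
    ∀ᵐ p ∂(volume.restrict (Ioo a b ×ˢ Ioo 0 T)), p ∈ inflowDomain a b T κ → f₀ p = 0 := by
  set R : Set (ℝ × ℝ) := Ioo a b ×ˢ Ioo 0 T with hRdef
  set D := inflowDomain a b T κ with hDdef
  have hRo : IsOpen R := isOpen_Ioo.prod isOpen_Ioo
  have hDR : D ⊆ R := fun p hp => hp.1
  have hDo : IsOpen D := isOpen_inflowDomain a b T κ
  have hR : ∀ p ∈ R, a < p.1 ∧ p.1 < b := fun p hp => hp.1
  have hmem : ∀ᵐ p ∂(volume.restrict R), p ∈ R := ae_restrict_mem hRo.measurableSet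
  have hVo : IsOpen (R ∩ {p | p.1 < a + η}) :=
    hRo.inter (isOpen_lt continuous_fst continuous_const)
  have hf₁ : ∀ᵐ p ∂(volume.restrict R), p.1 < a + η → f₁ p = 0 := by
    filter_upwards [h₀.ae_eq_zero hVo inter_subset_left (hf.mono fun p hp h => hp h.2), hmem]
      with p hp hpR h using hp ⟨hpR, h⟩
  have hf₂ : ∀ᵐ p ∂(volume.restrict R), p.1 < a + η → f₂ p = 0 := by
    filter_upwards [h₁.ae_eq_zero hVo inter_subset_left (hf₁.mono fun p hp h => hp h.2), hmem]
      with p hp hpR h using hp ⟨hpR, h⟩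
  have hg₀ : ∀ᵐ p ∂(volume.restrict R), p.1 < a + η → g p = 0 := by
    filter_upwards [hf₁, hg] with p hp hgp h
    rw [hp h] at hgp
    simpa using hgp
  have hfw : ∀ᵐ p ∂(volume.restrict R), p.1 < a + η → f₀ p - f₂ p = 0 := by
    filter_upwards [hf, hf₂] with p hp hp' h
    rw [hp h, hp' h, sub_zero]
  -- With this choice `(1 + C) / l² = 1 / (4 (1 + C)) ≤ 1 / 2`.
  set l : ℝ := 2 * (C + 1) with hl
  have hl0 : 0 < l := by positivity
  set E : ℝ × ℝ → ENNReal := fun p => ENNReal.ofReal (Real.exp (-l * p.1)) with hE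
  have hEm : Measurable E := by fun_prop
  have b₀ : ∫⁻ p in D, E p * ‖f₀ p‖ₑ ≤ ENNReal.ofReal (1 / l) * ∫⁻ p in D, E p * ‖f₁ p‖ₑ :=
    h₀.lintegral_le hl0 rfl hab hη hR hRo.measurableSet hDo hDR
      (fun p hp s => sub_smul_mem_inflowDomain_horizontal hp) hf hf₁
  have b₁ : ∫⁻ p in D, E p * ‖f₁ p‖ₑ ≤ ENNReal.ofReal (1 / l) * ∫⁻ p in D, E p * ‖f₂ p‖ₑ :=
    h₁.lintegral_le hl0 rfl hab hη hR hRo.measurableSet hDo hDR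
      (fun p hp s => sub_smul_mem_inflowDomain_horizontal hp) hf₁ hf₂
  have bw : ∫⁻ p in D, E p * ‖f₀ p - f₂ p‖ₑ ≤ ENNReal.ofReal (1 / l) * ∫⁻ p in D, E p * ‖g p‖ₑ :=
    hw.lintegral_le hl0 rfl hab hη hR hRo.measurableSet hDo hDR
      (fun p hp s => sub_smul_mem_inflowDomain hp) hfw hg₀
  have hgD : ∀ᵐ p ∂(volume.restrict D), |g p| ≤ C * |f₁ p| :=
    ae_mono (Measure.restrict_mono hDR le_rfl) hg
  have bg : ∫⁻ p in D, E p * ‖g p‖ₑ ≤ ENNReal.ofReal C * ∫⁻ p in D, E p * ‖f₁ p‖ₑ := by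
    rw [← lintegral_const_mul' _ _ ENNReal.ofReal_ne_top]
    refine lintegral_mono_ae (hgD.mono fun p hp => ?_)
    rw [mul_left_comm]
    gcongr
    rw [Real.enorm_eq_ofReal_abs, Real.enorm_eq_ofReal_abs, ← ENNReal.ofReal_mul hC]
    exact ENNReal.ofReal_le_ofReal hp
  have hf₀m : AEMeasurable (fun p => E p * ‖f₀ p‖ₑ) (volume.restrict D) :=
    hEm.aemeasurable.mul (h₀.integrable.mono_set hDR).aestronglyMeasurable.enorm
  -- This closes the loop: `f₂` has no derivative to be estimated by, but `f₂ = f₀ - (f₀ - f₂)` and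
  -- both terms are controlled by `f₁`.
  have b₂ : ∫⁻ p in D, E p * ‖f₂ p‖ₑ ≤
      (∫⁻ p in D, E p * ‖f₀ p‖ₑ) + ∫⁻ p in D, E p * ‖f₀ p - f₂ p‖ₑ := by
    rw [← lintegral_add_left' hf₀m]
    refine lintegral_mono fun p => ?_
    rw [← mul_add]
    gcongr
    calc ‖f₂ p‖ₑ = ‖f₀ p - (f₀ p - f₂ p)‖ₑ := by rw [sub_sub_cancel]
      _ ≤ _ := enorm_sub_le
  -- Finiteness is what allows `A₁ ≤ A₁ / 2` to force `A₁ = 0`.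
  have hfin : ∫⁻ p in D, E p * ‖f₁ p‖ₑ ≠ ⊤ := by
    have hi := (h₁.integrable.mono_set hDR).2
    refine ne_top_of_le_ne_top (b := ENNReal.ofReal (Real.exp (-l * a)) * ∫⁻ p in D, ‖f₁ p‖ₑ)
      (ENNReal.mul_ne_top ENNReal.ofReal_ne_top hi.ne) ?_
    rw [← lintegral_const_mul' _ _ ENNReal.ofReal_ne_top]
    refine setLIntegral_mono' hDo.measurableSet fun p hp => ?_
    refine mul_le_mul_left (ENNReal.ofReal_le_ofReal (Real.exp_le_exp.2 ?_)) _
    nlinarith [(hR p (hDR hp)).1]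
  have hA₁ : ∫⁻ p in D, E p * ‖f₁ p‖ₑ = 0 := by
    by_contra hne
    set A₁ := ∫⁻ p in D, E p * ‖f₁ p‖ₑ
    have hchain : A₁ ≤ ENNReal.ofReal (1 / 2) * A₁ := by
      calc A₁ ≤ ENNReal.ofReal (1 / l) * (ENNReal.ofReal (1 / l) * A₁ +
            ENNReal.ofReal (1 / l) * (ENNReal.ofReal C * A₁)) := by
            refine b₁.trans ?_
            gcongr
            refine b₂.trans ?_
            gcongr
            refine bw.trans ?_
            gcongr
        _ = ENNReal.ofReal (1 / l * (1 / l) * (1 + C)) * A₁ := by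
            rw [ENNReal.ofReal_mul (by positivity), ENNReal.ofReal_mul (by positivity),
              ENNReal.ofReal_add zero_le_one hC, ENNReal.ofReal_one]
            ring
        _ ≤ _ := by
            gcongr
            have : 1 / l * (1 / l) * (1 + C) = 1 / (4 * (1 + C)) := by
              rw [hl]; field_simp; ring
            rw [this]
            exact one_div_le_one_div_of_le (by norm_num) (by linarith)
    have hlt : ENNReal.ofReal (1 / 2) * A₁ < 1 * A₁ := by
      rw [ENNReal.mul_lt_mul_iff_left hne hfin]
      rw [← ENNReal.ofReal_one]
      exact (ENNReal.ofReal_lt_ofReal_iff one_pos).2 (by norm_num)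
    rw [one_mul] at hlt
    exact absurd hchain (not_le.2 hlt)
  have hA₀ : ∫⁻ p in D, E p * ‖f₀ p‖ₑ = 0 := by
    rw [hA₁, mul_zero] at b₀
    exact le_antisymm b₀ zero_le
  rw [lintegral_eq_zero_iff' hf₀m, Filter.EventuallyEq, ae_restrict_iff' hDo.measurableSet] at hA₀
  refine ae_restrict_of_ae (hA₀.mono fun p hp hpD => ?_)
  have := hp hpD
  simpa [hE, not_le.2 (Real.exp_pos _)] using this

/-- Unique continuation from both lateral sides of the rectangle, when every characteristic
meets one of them. -/
theorem ae_eq_zero_of_vanish_sides {a b T κ η C : ℝ} (hab : a < b) (hη : 0 < η) (hC : 0 ≤ C)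
    (hT : |κ| * (b - a) < T) {f₀ f₁ f₂ g : ℝ × ℝ → ℝ}
    (h₀ : IsWeakDirDeriv (Ioo a b ×ˢ Ioo 0 T) (1, 0) f₀ f₁)
    (h₁ : IsWeakDirDeriv (Ioo a b ×ˢ Ioo 0 T) (1, 0) f₁ f₂)
    (hw : IsWeakDirDeriv (Ioo a b ×ˢ Ioo 0 T) (1, κ) (fun p => f₀ p - f₂ p) g)
    (hg : ∀ᵐ p ∂(volume.restrict (Ioo a b ×ˢ Ioo 0 T)), |g p| ≤ C * |f₁ p|)
    (hl : ∀ᵐ p ∂(volume.restrict (Ioo a b ×ˢ Ioo 0 T)), p.1 < a + η → f₀ p = 0)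
    (hr : ∀ᵐ p ∂(volume.restrict (Ioo a b ×ˢ Ioo 0 T)), b - η < p.1 → f₀ p = 0) :
    ∀ᵐ p ∂(volume.restrict (Ioo a b ×ˢ Ioo 0 T)), f₀ p = 0 := by
  -- The reflection `p ↦ z - p` through the centre of the rectangle swaps its lateral sides and
  -- keeps the slope `κ`. The reflected system is solved by `f₀`, `-f₁`, `f₂`, `-g`, all evaluated
  -- at `z - p`.
  set z : ℝ × ℝ := (a + b, T) with hz
  have hzR : ∀ p, z - p ∈ Ioo a b ×ˢ Ioo 0 T ↔ p ∈ Ioo a b ×ˢ Ioo 0 T := fun p => by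
    simp only [hz, mem_prod, mem_Ioo, Prod.fst_sub, Prod.snd_sub]
    constructor <;> rintro ⟨⟨_, _⟩, _, _⟩ <;> refine ⟨⟨?_, ?_⟩, ?_, ?_⟩ <;> linarith
  have hleft := ae_eq_zero_inflowDomain hab hη hC h₀ h₁ hw hg hl
  have h₁' := (h₁.comp_const_sub hzR).neg
  simp only [neg_neg] at h₁'
  have hright := ae_eq_zero_inflowDomain hab hη hC (h₀.comp_const_sub hzR) h₁'
    (hw.comp_const_sub hzR) (by simpa using ae_comp_const_sub hzR hg) (by
      filter_upwards [ae_comp_const_sub hzR hr] with p hp hpx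
      exact hp (by simp only [hz, Prod.fst_sub]; linarith))
  have hright' := ae_comp_const_sub hzR hright
  have hmem : ∀ᵐ p ∂(volume.restrict (Ioo a b ×ˢ Ioo 0 T)), p ∈ Ioo a b ×ˢ Ioo 0 T :=
    ae_restrict_mem (isOpen_Ioo.prod isOpen_Ioo).measurableSet
  filter_upwards [hleft, hright', hmem] with p hp hp' hpR
  by_cases hD : p.2 - κ * (p.1 - a) ∈ Ioo 0 T
  · exact hp ⟨hpR, hD⟩
  · rw [sub_sub_cancel] at hp'
    refine hp' ⟨(hzR p).2 hpR, ?_⟩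
    -- The backward characteristic has left through `t = 0` if `κ ≥ 0`, through `t = T` if `κ ≤ 0`.
    -- As `|κ| (b - a) < T`, the forward one then reaches `x = b` at a time in `(0, T)`, which is
    -- the inflow condition at `z - p`.
    obtain ⟨⟨h1, h2⟩, h3, h4⟩ := hpR
    simp only [hz, mem_Ioo, not_and, not_lt, Prod.fst_sub, Prod.snd_sub] at hD ⊢
    rcases le_total 0 κ with hκ | hκ
    · rw [abs_of_nonneg hκ] at hT
      by_cases hpos : 0 < p.2 - κ * (p.1 - a)
      · exact absurd (hD hpos) (by nlinarith)
      · constructor <;> nlinarith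
    · rw [abs_of_nonpos hκ] at hT
      have := hD (by nlinarith)
      constructor <;> nlinarith

/-! ### From the torus to a rectangle -/

/-- The function on `Torus × ℝ` whose restriction to the fundamental domain `(a, a + 2π]` is `φ`. -/
noncomputable def periodize (a : ℝ) (φ : ℝ × ℝ → ℝ) (p : Torus × ℝ) : ℝ :=
  φ (AddCircle.equivIoc (2 * Real.pi) a p.1, p.2)

theorem periodize_coe (a : ℝ) (φ : ℝ × ℝ → ℝ) (y t : ℝ) :
    periodize a φ ((y : Torus), t) = φ (toIocMod Real.two_pi_pos a y, t) := rfl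

theorem periodize_coe_of_mem {a : ℝ} (φ : ℝ × ℝ → ℝ) {p : ℝ × ℝ}
    (hp : p.1 ∈ Ioo a (a + 2 * Real.pi)) : periodize a φ ((p.1 : Torus), p.2) = φ p := by
  rw [periodize_coe, (toIocMod_eq_self Real.two_pi_pos).2 ⟨hp.1, hp.2.le⟩]

theorem measurable_periodize (a : ℝ) {φ : ℝ × ℝ → ℝ} (hφ : Continuous φ) :
    Measurable (periodize a φ) := by
  have h1 : Measurable fun p : Torus × ℝ =>
      ((AddCircle.equivIoc (2 * Real.pi) a p.1 : ℝ), p.2) :=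
    (measurable_subtype_coe.comp ((AddCircle.measurableEquivIoc (2 * Real.pi) a).measurable.comp
      measurable_fst)).prodMk measurable_snd
  exact hφ.measurable.comp h1

/-- Locally, periodization is translation by a fixed multiple of `2π`, even at the seam where the
representative jumps: there both sides vanish, since `φ` is supported inside the open rectangle.
Smoothness and the formula for `dx` follow. -/
theorem eventuallyEq_periodize {a T : ℝ} {φ : ℝ × ℝ → ℝ}
    (hφ : IsPlaneTest (Ioo a (a + 2 * Real.pi) ×ˢ Ioo 0 T) φ) (y t : ℝ) :
    (fun q : ℝ × ℝ => periodize a φ ((q.1 : Torus), q.2)) =ᶠ[nhds (y, t)]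
      fun q => φ (q.1 - toIocDiv Real.two_pi_pos a y • (2 * Real.pi), q.2) := by
  set n := toIocDiv Real.two_pi_pos a y
  have hz := toIocMod_mem_Ioc Real.two_pi_pos a y
  have hself : ∀ x : ℝ, x - n • (2 * Real.pi) ∈ Ioc a (a + 2 * Real.pi) →
      toIocMod Real.two_pi_pos a x = x - n • (2 * Real.pi) := fun x hx => by
    rw [← toIocMod_sub_zsmul Real.two_pi_pos a x n, (toIocMod_eq_self Real.two_pi_pos).2 hx]
  have hc : Continuous fun q : ℝ × ℝ => q.1 - n • (2 * Real.pi) := by fun_prop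
  have hlow : ∀ᶠ q : ℝ × ℝ in nhds (y, t), a < q.1 - n • (2 * Real.pi) :=
    (isOpen_lt continuous_const hc).mem_nhds hz.1
  rcases hz.2.lt_or_eq with hlt | heq
  · have hup : ∀ᶠ q : ℝ × ℝ in nhds (y, t), q.1 - n • (2 * Real.pi) < a + 2 * Real.pi :=
      (isOpen_lt hc continuous_const).mem_nhds hlt
    filter_upwards [hlow, hup] with q h1 h2
    rw [periodize_coe, hself q.1 ⟨h1, h2.le⟩]
  · have hy : y - n • (2 * Real.pi) = a + 2 * Real.pi := heq
    have h0 : ∀ᶠ q in nhds (a, t), φ q = 0 := by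
      refine notMem_tsupport_iff_eventuallyEq.1 fun hmem => ?_
      exact lt_irrefl a (hφ.tsupport_subset hmem).1.1
    have hup : ∀ᶠ q : ℝ × ℝ in nhds (y, t), q.1 - n • (2 * Real.pi) < a + 2 * Real.pi + 2 * Real.pi :=
      (isOpen_lt hc continuous_const).mem_nhds (by
        simp only [mem_ofPred_eq, hy]; linarith [Real.two_pi_pos])
    have hc2 : Filter.Tendsto (fun q : ℝ × ℝ => (q.1 - n • (2 * Real.pi) - 2 * Real.pi, q.2))
        (nhds (y, t)) (nhds (a, t)) := by
      have : Continuous fun q : ℝ × ℝ => (q.1 - n • (2 * Real.pi) - 2 * Real.pi, q.2) := by fun_prop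
      have h := this.tendsto (y, t)
      simp only [hy, add_sub_cancel_right] at h
      exact h
    filter_upwards [hlow, hup, hc2.eventually h0] with q h1 h2 h3
    rw [periodize_coe]
    by_cases hle : q.1 - n • (2 * Real.pi) ≤ a + 2 * Real.pi
    · rw [hself q.1 ⟨h1, hle⟩]
    · rw [not_le] at hle
      have e : toIocMod Real.two_pi_pos a q.1 = q.1 - n • (2 * Real.pi) - 2 * Real.pi := by
        rw [← toIocMod_sub_zsmul Real.two_pi_pos a q.1 n, ← toIocMod_sub Real.two_pi_pos a,
          (toIocMod_eq_self Real.two_pi_pos).2 ⟨by linarith, by linarith⟩]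
      rw [e, h3]
      by_contra hne
      have := (hφ.tsupport_subset (subset_tsupport φ (Ne.symm hne))).1.2
      exact absurd hle (not_lt.2 this.le)

theorem contDiff_periodize {a T : ℝ} {φ : ℝ × ℝ → ℝ}
    (hφ : IsPlaneTest (Ioo a (a + 2 * Real.pi) ×ˢ Ioo 0 T) φ) :
    ContDiff ℝ ∞ (fun q : ℝ × ℝ => periodize a φ ((q.1 : Torus), q.2)) := by
  rw [contDiff_iff_contDiffAt]
  rintro ⟨y, t⟩
  refine ContDiffAt.congr_of_eventuallyEq ?_ (eventuallyEq_periodize hφ y t)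
  exact (hφ.smooth.comp ((contDiff_fst.sub contDiff_const).prodMk contDiff_snd)).contDiffAt

theorem isTestFunction_periodize {a T : ℝ} {φ : ℝ × ℝ → ℝ}
    (hφ : IsPlaneTest (Ioo a (a + 2 * Real.pi) ×ˢ Ioo 0 T) φ) :
    IsTestFunction T (periodize a φ) := by
  have hK : IsCompact (Prod.snd '' tsupport φ) := hφ.hasCompactSupport.isCompact.image continuous_snd
  have hsub : tsupport (periodize a φ) ⊆ univ ×ˢ (Prod.snd '' tsupport φ) :=
    closure_minimal (fun p hp => ⟨mem_univ _, _, subset_tsupport φ hp, rfl⟩)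
      (isClosed_univ.prod hK.isClosed)
  refine ⟨contDiff_periodize hφ, ?_, ?_⟩
  · exact (isCompact_univ.prod hK).of_isClosed_subset (isClosed_tsupport _) hsub
  · refine hsub.trans (prod_mono le_rfl ?_)
    rintro _ ⟨p, hp, rfl⟩
    exact (hφ.tsupport_subset hp).2

theorem dx_periodize {a T : ℝ} {φ : ℝ × ℝ → ℝ}
    (hφ : IsPlaneTest (Ioo a (a + 2 * Real.pi) ×ˢ Ioo 0 T) φ) :
    dx (periodize a φ) = periodize a (fun p => fderiv ℝ φ p (1, 0)) := by
  ext ⟨x, t⟩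
  obtain ⟨y, rfl⟩ := QuotientAddGroup.mk_surjective x
  set k : ℝ := toIocDiv Real.two_pi_pos a y • (2 * Real.pi) with hk
  have hline : Filter.Tendsto (fun h : ℝ => (y + h, t)) (nhds 0) (nhds (y, t)) := by
    have : Continuous fun h : ℝ => (y + h, t) := by fun_prop
    simpa using this.tendsto 0
  have he : (fun h : ℝ => periodize a φ (((y + h : ℝ) : Torus), t)) =ᶠ[nhds 0]
      fun h => φ (y + h - k, t) := hline.eventually (eventuallyEq_periodize hφ y t)
  have hd : HasDerivAt (fun h : ℝ => φ (y + h - k, t)) (fderiv ℝ φ (y - k, t) (1, 0)) 0 := by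
    have h1 : HasFDerivAt φ (fderiv ℝ φ (y - k, t)) (y + 0 - k, t) := by
      rw [add_zero]; exact (hφ.smooth.differentiable (by simp) _).hasFDerivAt
    have h2 : HasDerivAt (fun h : ℝ => (y + h - k, t)) ((1 : ℝ), (0 : ℝ)) 0 :=
      (((hasDerivAt_id (0 : ℝ)).const_add y).sub_const k).prodMk (hasDerivAt_const _ _)
    exact h1.comp_hasDerivAt (0 : ℝ) h2
  exact he.deriv_eq.trans hd.deriv

theorem dt_periodize {a T : ℝ} {φ : ℝ × ℝ → ℝ}
    (hφ : IsPlaneTest (Ioo a (a + 2 * Real.pi) ×ˢ Ioo 0 T) φ) :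
    dt (periodize a φ) = periodize a (fun p => fderiv ℝ φ p (0, 1)) := by
  ext ⟨x, t⟩
  set y : ℝ := (AddCircle.equivIoc (2 * Real.pi) a x : ℝ)
  have hd : HasDerivAt (fun s : ℝ => φ (y, s)) (fderiv ℝ φ (y, t) (0, 1)) t := by
    have h1 : HasFDerivAt φ (fderiv ℝ φ (y, t)) (y, t) :=
      (hφ.smooth.differentiable (by simp) _).hasFDerivAt
    have h2 : HasDerivAt (fun s : ℝ => (y, s)) ((0 : ℝ), (1 : ℝ)) t :=
      (hasDerivAt_const _ _).prodMk (hasDerivAt_id t)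
    exact h1.comp_hasDerivAt t h2
  exact HasDerivAt.deriv hd

theorem measurePreserving_coe (a T : ℝ) :
    MeasurePreserving (fun p : ℝ × ℝ => ((p.1 : Torus), p.2))
      (volume.restrict (Ioo a (a + 2 * Real.pi) ×ˢ Ioo 0 T)) (spaceTime T) := by
  have h1 := (AddCircle.measurePreserving_mk (2 * Real.pi) a).prod
    (MeasurePreserving.id ((volume : Measure ℝ).restrict (Ioo 0 T)))
  rw [← Measure.restrict_congr_set (Ioo_ae_eq_Ioc (μ := volume) (a := a) (b := a + 2 * Real.pi)),
    Measure.prod_restrict] at h1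
  exact h1

instance isFiniteMeasure_spaceTime (T : ℝ) : IsFiniteMeasure (spaceTime T) := by
  unfold spaceTime; infer_instance

theorem integral_spaceTime (a T : ℝ) {F : Torus × ℝ → ℝ}
    (hF : AEStronglyMeasurable F (spaceTime T)) :
    ∫ p, F p ∂(spaceTime T) =
      ∫ p in Ioo a (a + 2 * Real.pi) ×ˢ Ioo 0 T, F ((p.1 : Torus), p.2) := by
  have h := measurePreserving_coe a T
  rw [← h.map_eq] at hF ⊢
  exact integral_map h.aemeasurable hF

theorem ae_of_ae_coe (a T : ℝ) {P : Torus × ℝ → Prop} (hP : NullMeasurableSet {p | P p} (spaceTime T))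
    (h : ∀ᵐ p ∂(volume.restrict (Ioo a (a + 2 * Real.pi) ×ˢ Ioo 0 T)), P ((p.1 : Torus), p.2)) :
    ∀ᵐ p ∂(spaceTime T), P p := by
  have hm := measurePreserving_coe a T
  rw [← hm.map_eq] at hP ⊢
  exact (Measure.map_apply₀ hm.aemeasurable hP.compl).trans h

theorem integrableOn_coe (a T : ℝ) {F : Torus × ℝ → ℝ} (hF : Integrable F (spaceTime T)) :
    IntegrableOn (fun p : ℝ × ℝ => F ((p.1 : Torus), p.2))
      (Ioo a (a + 2 * Real.pi) ×ˢ Ioo 0 T) :=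
  (measurePreserving_coe a T).integrable_comp_of_integrable hF

theorem integrable_mul_periodize {a T : ℝ} {F : Torus × ℝ → ℝ} {φ : ℝ × ℝ → ℝ}
    {R : Set (ℝ × ℝ)} (hF : Integrable F (spaceTime T)) (hφ : IsPlaneTest R φ) :
    Integrable (fun p => F p * periodize a φ p) (spaceTime T) := by
  obtain ⟨C, hC⟩ := hφ.exists_bound
  exact hF.mul_bdd (measurable_periodize a hφ.smooth.continuous).aestronglyMeasurable
    (Filter.Eventually.of_forall fun p => hC _)

theorem integral_mul_periodize {a T : ℝ} {F : Torus × ℝ → ℝ} {φ : ℝ × ℝ → ℝ}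
    {R : Set (ℝ × ℝ)} (hF : Integrable F (spaceTime T)) (hφ : IsPlaneTest R φ) :
    ∫ p, F p * periodize a φ p ∂(spaceTime T) =
      ∫ p in Ioo a (a + 2 * Real.pi) ×ˢ Ioo 0 T, F ((p.1 : Torus), p.2) * φ p := by
  rw [integral_spaceTime a T (integrable_mul_periodize hF hφ).aestronglyMeasurable]
  refine setIntegral_congr_fun (isOpen_Ioo.prod isOpen_Ioo).measurableSet fun p hp => ?_
  simp only [periodize_coe_of_mem φ hp.1]

/-- Fubini reduces the claim to almost every time slice, where the periodized test function is
admissible on the torus. -/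
theorem IsWeakSpaceDeriv.isWeakDirDeriv {T : ℝ} {u v : Torus × ℝ → ℝ}
    (h : IsWeakSpaceDeriv T u v) (hu : Integrable u (spaceTime T))
    (hv : Integrable v (spaceTime T)) (a : ℝ) :
    IsWeakDirDeriv (Ioo a (a + 2 * Real.pi) ×ˢ Ioo 0 T) (1, 0)
      (fun p => u ((p.1 : Torus), p.2)) (fun p => v ((p.1 : Torus), p.2)) where
  integrable := integrableOn_coe a T hu
  integrable_deriv := integrableOn_coe a T hv
  integral_eq φ hφ := by
    have i1 := integrable_mul_periodize (a := a) hu (hφ.fderiv_apply (1, 0))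
    have i2 := integrable_mul_periodize (a := a) hv hφ
    rw [← integral_mul_periodize hu (hφ.fderiv_apply (1, 0)), ← integral_mul_periodize hv hφ]
    unfold spaceTime at i1 i2 ⊢
    rw [integral_prod_symm _ i1, integral_prod_symm _ i2, ← integral_neg]
    refine integral_congr_ae ?_
    filter_upwards [h] with t ht
    have hs : TorusSmooth (fun x => periodize a φ (x, t)) :=
      (contDiff_periodize hφ).comp (contDiff_id.prodMk contDiff_const)
    rw [← dx_periodize hφ]
    exact ht.2.2 _ hs

/-! ### The transport equation for `u - u_xx` -/

theorem fderiv_fderiv_comm {φ : ℝ × ℝ → ℝ} (hφ : ContDiff ℝ ∞ φ) (v w p : ℝ × ℝ) :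
    fderiv ℝ (fun q => fderiv ℝ φ q v) p w = fderiv ℝ (fun q => fderiv ℝ φ q w) p v := by
  have hd : DifferentiableAt ℝ (fderiv ℝ φ) p :=
    (hφ.fderiv_right (m := ∞) (by simp)).differentiable (by simp) p
  have hs := ((contDiff_infty.1 hφ 2).contDiffAt (x := p)).isSymmSndFDerivAt (by simp)
  have e : ∀ v : ℝ × ℝ, fderiv ℝ (fun q => fderiv ℝ φ q v) p =
      (fderiv ℝ (fderiv ℝ φ) p).flip v := fun v => by
    rw [fderiv_clm_apply hd (differentiableAt_const v)]; simp
  rw [e, e]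
  exact hs w v

/-- Two weak derivatives of the same function agree. -/
theorem IsWeakDirDeriv.unique {R : Set (ℝ × ℝ)} (hR : IsOpen R) {v : ℝ × ℝ} {f g g' : ℝ × ℝ → ℝ}
    (h : IsWeakDirDeriv R v f g) (h' : IsWeakDirDeriv R v f g') :
    ∀ᵐ p ∂(volume.restrict R), g p = g' p := by
  have h0 : IsWeakDirDeriv R v (fun _ => 0) (fun p => g p - g' p) := by
    refine ⟨integrableOn_zero, h.integrable_deriv.sub h'.integrable_deriv, fun φ hφ => ?_⟩
    obtain ⟨C, hC⟩ := hφ.exists_bound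
    have hm := hφ.smooth.continuous.aestronglyMeasurable (μ := volume.restrict R)
    have e1 := h.integral_eq φ hφ
    have e2 := h'.integral_eq φ hφ
    simp only [zero_mul, integral_zero, sub_mul]
    rw [integral_sub (h.integrable_deriv.mul_bdd hm (Filter.Eventually.of_forall hC))
      (h'.integrable_deriv.mul_bdd hm (Filter.Eventually.of_forall hC))]
    linarith
  filter_upwards [h0.ae_eq_zero hR le_rfl (by simp), ae_restrict_mem hR.measurableSet] with p hp hpR
  exact sub_eq_zero.1 (hp hpR)

/-- The equation, written as a transport equation for `u - u_xx`. -/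
theorem isWeakDirDeriv_transport {c T : ℝ} (hc : c ≠ 0) {q u ux ux' uxx : Torus × ℝ → ℝ}
    (hu : Integrable u (spaceTime T)) (hux : Integrable ux (spaceTime T))
    (hux' : Integrable ux' (spaceTime T))
    (huxx : Integrable uxx (spaceTime T)) (hqux : Integrable (fun p => q p * ux' p) (spaceTime T))
    (h₀ : IsWeakSpaceDeriv T u ux) (h₁ : IsWeakSpaceDeriv T ux uxx)
    (h₀' : IsWeakSpaceDeriv T u ux')
    (hsol : ∀ φ : Torus × ℝ → ℝ, IsTestFunction T φ →
      ∫ p, (u p * (- dt φ p + dt (dx (dx φ)) p + c * dx (dx (dx φ)) p)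
        + q p * ux' p * φ p) ∂(spaceTime T) = 0) (a : ℝ) :
    IsWeakDirDeriv (Ioo a (a + 2 * Real.pi) ×ˢ Ioo 0 T) (1, 1 / c)
      (fun p => u ((p.1 : Torus), p.2) - uxx ((p.1 : Torus), p.2))
      (fun p => ux' ((p.1 : Torus), p.2) -
        1 / c * (q ((p.1 : Torus), p.2) * ux' ((p.1 : Torus), p.2))) where
  integrable := (integrableOn_coe a T hu).sub (integrableOn_coe a T huxx)
  integrable_deriv := (integrableOn_coe a T hux').sub ((integrableOn_coe a T hqux).const_mul _)
  integral_eq φ hφ := by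
    have tx := hφ.fderiv_apply (1, 0)
    have tt := hφ.fderiv_apply (0, 1)
    have txx := tx.fderiv_apply (1, 0)
    have ttx := tt.fderiv_apply (1, 0)
    have txxt := txx.fderiv_apply (0, 1)
    have txxx := txx.fderiv_apply (1, 0)
    have w₀ := h₀.isWeakDirDeriv hu hux a
    have w₁ := h₁.isWeakDirDeriv hux huxx a
    have w₀' := h₀'.isWeakDirDeriv hu hux' a
    -- With the space derivatives outermost, two of them can be moved onto `u`, although `u` has no
    -- weak time derivative.
    have hcomm : ∀ p, fderiv ℝ (fun p => fderiv ℝ (fun p => fderiv ℝ φ p (1, 0)) p (1, 0)) p (0, 1) =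
        fderiv ℝ (fun p => fderiv ℝ (fun p => fderiv ℝ φ p (0, 1)) p (1, 0)) p (1, 0) := fun p => by
      rw [fderiv_fderiv_comm tx.smooth, funext (fderiv_fderiv_comm hφ.smooth (1, 0) (0, 1))]
    have key := hsol _ (isTestFunction_periodize hφ)
    rw [dt_periodize hφ, dx_periodize hφ, dx_periodize tx, dt_periodize txx,
      dx_periodize txx] at key
    have esplit : ∀ p, u p * (-periodize a (fun p => fderiv ℝ φ p (0, 1)) p +
          periodize a (fun p => fderiv ℝ (fun p => fderiv ℝ (fun p => fderiv ℝ φ p (1, 0)) p (1, 0))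
            p (0, 1)) p +
          c * periodize a (fun p => fderiv ℝ (fun p => fderiv ℝ (fun p => fderiv ℝ φ p (1, 0))
            p (1, 0)) p (1, 0)) p) + q p * ux' p * periodize a φ p =
        -(u p * periodize a (fun p => fderiv ℝ φ p (0, 1)) p) +
          u p * periodize a (fun p => fderiv ℝ (fun p => fderiv ℝ (fun p => fderiv ℝ φ p (1, 0))
            p (1, 0)) p (0, 1)) p +
          c * (u p * periodize a (fun p => fderiv ℝ (fun p => fderiv ℝ (fun p => fderiv ℝ φ p (1, 0))
            p (1, 0)) p (1, 0)) p) + q p * ux' p * periodize a φ p := fun p => by ring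
    have j₁ := integrable_mul_periodize (a := a) hu tt
    have j₂ := integrable_mul_periodize (a := a) hu txxt
    have j₃ := integrable_mul_periodize (a := a) hu txxx
    have j₄ := integrable_mul_periodize (a := a) hqux hφ
    rw [integral_congr_ae (Filter.Eventually.of_forall esplit),
      integral_add ((j₁.fun_neg.fun_add j₂).fun_add (j₃.const_mul c)) j₄,
      integral_add (j₁.fun_neg.fun_add j₂) (j₃.const_mul c),
      integral_add j₁.fun_neg j₂, integral_neg, integral_const_mul,
      integral_mul_periodize hu tt, integral_mul_periodize hu txxt,
      integral_mul_periodize hu txxx, integral_mul_periodize hqux hφ] at key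
    simp only [hcomm] at key
    -- Two integrations by parts turn `u φ_txx` and `u φ_xxx` into `uxx φ_t` and `uxx φ_x`. Dividing
    -- by `c` and adding `∫ u φ_x = -∫ ux' φ` gives the claim.
    rw [w₀.integral_eq _ ttx, w₁.integral_eq _ tt, w₀.integral_eq _ txx, w₁.integral_eq _ tx] at key
    have e₀ := w₀'.integral_eq φ hφ
    have hdir : ∀ p, fderiv ℝ φ p (1, 1 / c) =
        fderiv ℝ φ p (1, 0) + 1 / c * fderiv ℝ φ p (0, 1) := fun p => by
      have : ((1 : ℝ), 1 / c) = (1, 0) + (1 / c) • ((0 : ℝ), (1 : ℝ)) := by simp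
      rw [this, map_add, map_smul, smul_eq_mul]
    have mul_int : ∀ {F : Torus × ℝ → ℝ} {ψ : ℝ × ℝ → ℝ}, Integrable F (spaceTime T) →
        IsPlaneTest (Ioo a (a + 2 * Real.pi) ×ˢ Ioo 0 T) ψ →
        Integrable (fun p : ℝ × ℝ => F ((p.1 : Torus), p.2) * ψ p)
          (volume.restrict (Ioo a (a + 2 * Real.pi) ×ˢ Ioo 0 T)) := fun hF hψ => by
      obtain ⟨C, hC⟩ := hψ.exists_bound
      exact (integrableOn_coe a T hF).mul_bdd hψ.smooth.continuous.aestronglyMeasurable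
        (Filter.Eventually.of_forall hC)
    have eL : ∀ p : ℝ × ℝ, (u ((p.1 : Torus), p.2) - uxx ((p.1 : Torus), p.2)) *
        fderiv ℝ φ p (1, 1 / c) =
        (u ((p.1 : Torus), p.2) * fderiv ℝ φ p (1, 0) +
          1 / c * (u ((p.1 : Torus), p.2) * fderiv ℝ φ p (0, 1))) -
        (uxx ((p.1 : Torus), p.2) * fderiv ℝ φ p (1, 0) +
          1 / c * (uxx ((p.1 : Torus), p.2) * fderiv ℝ φ p (0, 1))) := fun p => by
      rw [hdir]; ring
    have eR : ∀ p : ℝ × ℝ, (ux' ((p.1 : Torus), p.2) -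
        1 / c * (q ((p.1 : Torus), p.2) * ux' ((p.1 : Torus), p.2))) * φ p =
        ux' ((p.1 : Torus), p.2) * φ p -
        1 / c * (q ((p.1 : Torus), p.2) * ux' ((p.1 : Torus), p.2) * φ p) := fun p => by ring
    rw [integral_congr_ae (Filter.Eventually.of_forall eL),
      integral_congr_ae (Filter.Eventually.of_forall eR),
      integral_sub ((mul_int hu tx).fun_add ((mul_int hu tt).const_mul _))
        ((mul_int huxx tx).fun_add ((mul_int huxx tt).const_mul _)),
      integral_add (mul_int hu tx) ((mul_int hu tt).const_mul _),
      integral_add (mul_int huxx tx) ((mul_int huxx tt).const_mul _),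
      integral_sub (mul_int hux' hφ) ((mul_int hqux hφ).const_mul _)]
    simp only [integral_const_mul]
    rw [e₀]
    field_simp
    linarith

end KdVBBM

/-! ### Conclusion -/

theorem theorem5p1 (c T : ℝ) (hc : c ≠ 0) (hT : 2 * Real.pi / |c| < T)
    (q : KdVBBM.Torus × ℝ → ℝ) (hq : MemLp q ⊤ (KdVBBM.spaceTime T))
    (W : Set KdVBBM.Torus) (hW_open : IsOpen W) (hW_nonempty : W.Nonempty)
    (u : KdVBBM.Torus × ℝ → ℝ) (hu : KdVBBM.MemL2H2 T u)
    (hsol : KdVBBM.IsSolution c T q u)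
    (hvanish : ∀ᵐ p ∂(KdVBBM.spaceTime T), p.1 ∈ W → u p = 0) :
    ∀ᵐ p ∂(KdVBBM.spaceTime T), u p = 0 := by
  obtain ⟨hu2, ux, uxx, hux2, huxx2, h₀, h₁⟩ := hu
  obtain ⟨ux', hux2', h₀', hsol⟩ := hsol
  have hui := hu2.integrable one_le_two
  have huxi := hux2.integrable one_le_two
  have huxi' := hux2'.integrable one_le_two
  have huxxi := huxx2.integrable one_le_two
  set Cq : ℝ := (eLpNorm q ⊤ (KdVBBM.spaceTime T)).toReal with hCq
  have hqb : ∀ᵐ p ∂(KdVBBM.spaceTime T), ‖q p‖ ≤ Cq := by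
    filter_upwards [ae_le_eLpNormEssSup (f := q) (μ := KdVBBM.spaceTime T)] with p hp
    rw [← eLpNorm_exponent_top] at hp
    rw [hCq, ← toReal_enorm]
    exact ENNReal.toReal_mono hq.2.ne hp
  have hqux : Integrable (fun p => q p * ux' p) (KdVBBM.spaceTime T) :=
    huxi'.bdd_mul hq.1 hqb
  obtain ⟨x₀, hx₀⟩ := hW_nonempty
  -- Cutting the torus at a point of `W` puts both lateral sides of the rectangle inside the
  -- vanishing region.
  obtain ⟨a, rfl⟩ := QuotientAddGroup.mk_surjective x₀
  have hpre : IsOpen ((fun x : ℝ => (x : KdVBBM.Torus)) ⁻¹' W) :=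
    hW_open.preimage (AddCircle.continuous_mk' _)
  obtain ⟨η, hη, hball⟩ := Metric.isOpen_iff.1 hpre a hx₀
  set R : Set (ℝ × ℝ) := Ioo a (a + 2 * Real.pi) ×ˢ Ioo 0 T with hR
  have hRo : IsOpen R := isOpen_Ioo.prod isOpen_Ioo
  have hmem : ∀ᵐ p ∂(volume.restrict R), p ∈ R := ae_restrict_mem hRo.measurableSet
  have hqmp := (KdVBBM.measurePreserving_coe a T).quasiMeasurePreserving
  have hv := hqmp.ae hvanish
  have w₀ := h₀.isWeakDirDeriv hui huxi a
  have w₀' := h₀'.isWeakDirDeriv hui huxi' a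
  refine KdVBBM.ae_of_ae_coe a T
    (nullMeasurableSet_eq_fun hui.aestronglyMeasurable.aemeasurable aemeasurable_const) ?_
  refine KdVBBM.ae_eq_zero_of_vanish_sides (C := 1 + Cq / |c|) (κ := 1 / c)
    (by linarith [Real.two_pi_pos]) hη (by positivity) ?_ w₀ (h₁.isWeakDirDeriv huxi huxxi a)
    (KdVBBM.isWeakDirDeriv_transport hc hui huxi huxi' huxxi hqux h₀ h₁ h₀' hsol a) ?_ ?_ ?_
  · rw [abs_div, abs_one, add_sub_cancel_left]
    calc 1 / |c| * (2 * Real.pi) = 2 * Real.pi / |c| := by ring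
      _ < T := hT
  -- The derivative `ux'` in the equation and the `ux` of the `H²` hypothesis are given separately;
  -- uniqueness of weak derivatives identifies them.
  · filter_upwards [w₀.unique hRo w₀', hqmp.ae hqb] with p hp hpq
    rw [hp]
    set x := ux' ((p.1 : KdVBBM.Torus), p.2)
    set r := q ((p.1 : KdVBBM.Torus), p.2)
    calc |x - 1 / c * (r * x)| = |1 - r / c| * |x| := by rw [← abs_mul]; congr 1; ring
      _ ≤ (|1| + |r / c|) * |x| := by gcongr; exact abs_sub _ _
      _ ≤ _ := by
        rw [abs_one, abs_div]
        rw [Real.norm_eq_abs] at hpq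
        gcongr
  · filter_upwards [hv, hmem] with p hp hpR hpx
    exact hp (hball (by rw [Real.ball_eq_Ioo]; exact ⟨by linarith [hpR.1.1], hpx⟩))
  · filter_upwards [hv, hmem] with p hp hpR hpx
    refine hp ?_
    have : p.1 - 2 * Real.pi ∈ Metric.ball a η := by
      rw [Real.ball_eq_Ioo]; exact ⟨by linarith, by linarith [hpR.1.2]⟩
    have hW := hball this
    simpa only [mem_preimage, AddCircle.coe_sub, AddCircle.coe_period, sub_zero] using hW
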